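/- Let $S$ and $C$ be quantum systems with finite-dimensional Hilbert spaces $\mathcal H_S,\mathcal H_C$ and Hamiltonians (Hermitian operators) $H_S,H_C$. For a system with Hamiltonian $H$, a translationally invariant (time-covariant) operation (TIO) is a completely positive trace-preserving linear map $\mathcal E$ from the operators on its Hilbert space to themselves such that $\mathcal E(e^{-iHt}Xe^{iHt})=e^{-iHt}\mathcal E(X)e^{iHt}$ for all operators $X$ and all $t\in\mathbb R$. The composite system $SC$ has the Hamiltonian $H_S\otimes\mathbb 1+\mathbb 1\otimes H_C$. **Theorem.** Let $\rho$ and $\rho'$ be arbitrary states (density matrices) of $S$ such that no TIO $\mathcal E$ of $S$ satisfies $\mathcal E(\rho)=\rho'$. Then, for every finite-dimensional system $C$, every Hamiltonian $H_C$ and every pure state (unit vector) $|\phi\rangle\in\mathcal H_C$, no TIO $\mathcal E$ of $SC$ satisfies $\mathcal E(\rho\otimes|\phi\rangle\langle\phi|)=\rho'\otimes|\phi\rangle\langle\phi|$. -/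

import Mathlib

/-! A finite-dimensional quantum system is described in a fixed orthonormal basis, indexed by a
finite type `s`; operators on it are matrices `Matrix s s ℂ`. -/

/-- The time evolution operator `e^{-iHt}` generated by the Hamiltonian `H`. -/
noncomputable def timeEvolution {s : Type*} [Fintype s] [DecidableEq s]
    (H : Matrix s s ℂ) (t : ℝ) : Matrix s s ℂ :=
  NormedSpace.exp ((-(Complex.I * (t : ℂ))) • H)

section State

/- The order on `ℂ` that `Matrix.PosSemidef` refers to. -/
open scoped ComplexOrder

/-- A quantum state (density matrix): positive semidefinite of trace one. -/
structure IsDensityMatrix {s : Type*} [Fintype s] (ρ : Matrix s s ℂ) : Prop where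
  posSemidef : ρ.PosSemidef
  trace_eq_one : ρ.trace = 1

end State

/-- The rank-one operator `|φ⟩⟨φ|`. -/
def ketBra {c : Type*} (φ : EuclideanSpace ℂ c) : Matrix c c ℂ :=
  Matrix.vecMulVec φ.ofLp (star φ.ofLp)

/-- The Hamiltonian `H_S ⊗ 1 + 1 ⊗ H_C` of a composite system without interaction. -/
def totalHamiltonian {s c : Type*} [DecidableEq s] [DecidableEq c]
    (HS : Matrix s s ℂ) (HC : Matrix c c ℂ) : Matrix (s × c) (s × c) ℂ :=
  Matrix.kronecker HS (1 : Matrix c c ℂ) + Matrix.kronecker (1 : Matrix s s ℂ) HC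

section CompletelyPositive

/- These scopes provide the C⋆-algebra structure (operator norm) and the Loewner order of complex
matrices, which Mathlib's completely positive maps `→CP` refer to. -/
open scoped MatrixOrder Matrix.Norms.L2Operator CStarAlgebra

/-- A translationally invariant operation (TIO) of a system with Hamiltonian `H`: a completely
positive trace-preserving linear map that commutes with the time evolution. -/
structure IsTIO {s : Type*} [Fintype s] [DecidableEq s]
    (H : Matrix s s ℂ) (E : Matrix s s ℂ →CP Matrix s s ℂ) : Prop where
  trace_map : ∀ X : Matrix s s ℂ, (E X).trace = X.trace
  covariant : ∀ (t : ℝ) (X : Matrix s s ℂ),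
    E (timeEvolution H t * X * timeEvolution H (-t)) =
      timeEvolution H t * E X * timeEvolution H (-t)

/-- `ρ` can be transformed to `ρ'` under TIO (for the Hamiltonian `H`). -/
def TIOConvertible {s : Type*} [Fintype s] [DecidableEq s]
    (H ρ ρ' : Matrix s s ℂ) : Prop :=
  ∃ E : Matrix s s ℂ →CP Matrix s s ℂ, IsTIO H E ∧ E ρ = ρ'

end CompletelyPositive

/-!
Given a TIO `E` of the composite system with `E (ρ ⊗ |φ⟩⟨φ|) = ρ' ⊗ |φ⟩⟨φ|`, a TIO of `S` alone
mapping `ρ` to `ρ'` is constructed.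

Work in product eigenbases of the two Hamiltonians. Averaging over time shows that `E` has Kraus
operators `K a`, each of which shifts the energy by a fixed amount `ω a`
(`exists_covariantKraus_of_isTIO`). Write `ρ = A Aᴴ`. The output of `E` being a product with the
*pure* state `φ`, every `K a` maps the columns of `A ⊗ φ` to vectors of the form `B a ⊗ φ`, and
`∑ a, B a (B a)ᴴ = ρ'`.

The heart of the matter is that the catalyst drops out of the energy-resolved Gram matrices. Let
`P x` be the spectral projection of `H_S` at energy `x`, let `μ j` be the energies of `C`, and put
`D x = Aᴴ P x A - ∑ a, (B a)ᴴ P (x + ω a) (B a)`. Since `∑ a, (K a)ᴴ K a = 1` and `K a` shifts the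
total energy by `ω a`, one gets `∑ j, |φ j|² D (x - μ j) = 0` for every `x`. The function `D` has
finite support, and convolution with the nonzero nonnegative measure `∑ j, |φ j|² δ (μ j)` is
injective on such functions, as a look at the largest energies shows
(`eq_zero_of_sum_translates_eq_zero`). Hence `D = 0` (`IsCovariantKraus.exists_gram_eq`).

Equality of the Gram matrices at each energy yields a partial isometry taking the columns of
`P x A` to those of the stack of all `P (x + ω a) (B a)`. Gluing these over `x` gives operators
`V a` of `S` that shift the energy by `ω a` and satisfy `V a A = B a`. They are completed to the
Kraus operators of a TIO by one projection that commutes with `H_S` and annihilates `A`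
(`exists_covariantKraus_of_gram_eq`), and this TIO maps `A Aᴴ = ρ` to `∑ a, B a (B a)ᴴ = ρ'`.
-/

open Matrix

/-! ### Kraus representations of completely positive maps -/

section Kraus

open scoped MatrixOrder Matrix.Norms.L2Operator CStarAlgebra

/-- `CStarAlgebra.nonneg_iff_eq_star_mul_self` over an abstract algebra: for `CStarMatrix`, instance
search does not find the continuous functional calculus that the Mathlib lemma asks for. -/
lemma exists_eq_star_mul_self_of_nonneg {A : Type*} [NonUnitalCStarAlgebra A] [PartialOrder A]
    [StarOrderedRing A] {a : A} (ha : 0 ≤ a) : ∃ b, a = star b * b :=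
  CStarAlgebra.nonneg_iff_eq_star_mul_self.mp ha

/-- Choi's theorem: the matrix with entries `E |i⟩⟨j|` is positive, and hence
of the form `star R * R`, and `R` supplies the Kraus operators. -/
lemma exists_kraus {n : Type*} [Fintype n] [DecidableEq n]
    (E : Matrix n n ℂ →CP Matrix n n ℂ) :
    ∃ K : n × n → Matrix n n ℂ, ∀ X, E X = ∑ a, K a * X * (K a)ᴴ := by
  let M : CStarMatrix n n (Matrix n n ℂ) :=
    CStarMatrix.ofMatrix (Matrix.of fun i j => Matrix.single i j (1 : ℂ))
  have hM : 0 ≤ M := by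
    rcases isEmpty_or_nonempty n with hn | ⟨⟨k₀⟩⟩
    · exact le_of_eq (by ext i; exact hn.elim i)
    let N : CStarMatrix n n (Matrix n n ℂ) :=
      CStarMatrix.ofMatrix (Matrix.of fun k i => if k = k₀ then Matrix.single k₀ i (1 : ℂ) else 0)
    -- `N` consists of the single row of matrix units `|k₀⟩⟨i|`.
    have : M = star N * N := by
      refine CStarMatrix.ext fun i j => ?_
      rw [CStarMatrix.mul_apply, Finset.sum_eq_single k₀]
      · simp [M, N, CStarMatrix.star_apply, CStarMatrix.ofMatrix_apply, star_eq_conjTranspose]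
      · intro b _ hb
        simp [N, CStarMatrix.star_apply, CStarMatrix.ofMatrix_apply, hb]
      · simp
    rw [this]
    exact star_mul_self_nonneg N
  obtain ⟨R, hR⟩ := exists_eq_star_mul_self_of_nonneg
    (CompletelyPositiveMap.map_cstarMatrix_nonneg E M hM)
  have hE (i j p q : n) :
      E (Matrix.single i j 1) p q = ∑ k, ∑ r, star (R k i r p) * R k j r q := by
    have := congrFun (congrFun (congrFun (congrFun hR i) j) p) q
    rw [CStarMatrix.mul_apply, Matrix.sum_apply] at this
    refine Eq.trans this ?_
    refine Finset.sum_congr rfl fun k _ => ?_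
    rw [Matrix.mul_apply]
    rfl
  refine ⟨fun a => Matrix.of fun p i => star (R a.1 i a.2 p), fun X => ?_⟩
  ext p q
  conv_lhs => rw [Matrix.matrix_eq_sum_single X]
  simp only [map_sum, Matrix.sum_apply]
  have h1 (i j : n) : E (Matrix.single i j (X i j)) p q
      = X i j * ∑ k, ∑ r, star (R k i r p) * R k j r q := by
    rw [← hE, ← mul_one (X i j), ← smul_eq_mul, ← Matrix.smul_single, map_smul]
    simp
  simp only [h1, Matrix.mul_apply, Fintype.sum_prod_type, Finset.mul_sum, Finset.sum_mul,
    Matrix.of_apply, Matrix.conjTranspose_apply, star_star]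
  rw [Finset.sum_comm_cycle]
  refine Finset.sum_congr rfl fun k _ => ?_
  rw [Finset.sum_comm_cycle]
  refine Finset.sum_congr rfl fun r _ => ?_
  rw [Finset.sum_comm]
  refine Finset.sum_congr rfl fun j _ => Finset.sum_congr rfl fun i _ => ?_
  ring

lemma exists_cpMap_of_kraus {n κ : Type*} [Fintype n] [DecidableEq n] [Fintype κ]
    (K : κ → Matrix n n ℂ) :
    ∃ E : Matrix n n ℂ →CP Matrix n n ℂ, ∀ X, E X = ∑ a, K a * X * (K a)ᴴ := by
  let F : Matrix n n ℂ →ₗ[ℂ] Matrix n n ℂ :=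
    { toFun := fun X => ∑ a, K a * X * (K a)ᴴ
      map_add' := fun X Y => by simp [mul_add, add_mul, Finset.sum_add_distrib]
      map_smul' := fun c X => by simp [Finset.smul_sum] }
  refine ⟨⟨F, fun k M hM => ?_⟩, fun X => rfl⟩
  obtain ⟨R, rfl⟩ := exists_eq_star_mul_self_of_nonneg hM
  let Y (a : κ) : CStarMatrix (Fin k) (Fin k) (Matrix n n ℂ) :=
    CStarMatrix.ofMatrix (Matrix.of fun i j => R i j * (K a)ᴴ)
  have h : (star R * R).map F = ∑ a, star (Y a) * Y a := by
    refine CStarMatrix.ext fun i j => ?_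
    have hs : (∑ a, star (Y a) * Y a) i j = ∑ a, (star (Y a) * Y a) i j :=
      Matrix.sum_apply i j Finset.univ fun a => (star (Y a) * Y a : CStarMatrix _ _ _)
    rw [hs, CStarMatrix.map_apply]
    change ∑ a, K a * (star R * R) i j * (K a)ᴴ = _
    refine Finset.sum_congr rfl fun a _ => ?_
    simp only [CStarMatrix.mul_apply, Finset.mul_sum, Finset.sum_mul]
    refine Finset.sum_congr rfl fun l _ => ?_
    simp [Y, CStarMatrix.star_apply, CStarMatrix.ofMatrix_apply, star_eq_conjTranspose,
      Matrix.mul_assoc]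
  rw [h]
  exact Finset.sum_nonneg fun a _ => star_mul_self_nonneg (Y a)

end Kraus

/-! ### Kraus representations of translationally invariant operations -/

/-- `K` is a family of Kraus operators of a trace-preserving map such that, for the Hamiltonian
`diagonal e`, each `K a` shifts the energy by the fixed amount `ω a`. -/
structure IsCovariantKraus {n κ : Type*} [Fintype n] [DecidableEq n] [Fintype κ]
    (e : n → ℝ) (ω : κ → ℝ) (K : κ → Matrix n n ℂ) : Prop where
  sum_eq_one : ∑ a, (K a)ᴴ * K a = 1
  mode : ∀ a k m, K a k m ≠ 0 → e k - e m = ω a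

section Covariance

open scoped MatrixOrder Matrix.Norms.L2Operator CStarAlgebra

variable {n : Type*} [Fintype n] [DecidableEq n]

lemma timeEvolution_conj_diagonal {U : Matrix n n ℂ} (hU : U * Uᴴ = 1) (e : n → ℝ) (t : ℝ) :
    timeEvolution (U * diagonal (fun i => (e i : ℂ)) * Uᴴ) t =
      U * diagonal (fun i => Complex.exp (-(Complex.I * t) * e i)) * Uᴴ := by
  have hinv : U⁻¹ = Uᴴ := inv_eq_right_inv hU
  have hunit : IsUnit U := IsUnit.of_mul_eq_one _ hU
  rw [timeEvolution, ← hinv, ← Matrix.smul_mul, ← Matrix.mul_smul, exp_conj _ _ hunit,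
    ← diagonal_smul, exp_diagonal]
  congr 3
  funext i
  rw [Pi.coe_exp]
  simp [Complex.exp_eq_exp_ℂ]

lemma sum_mul_mul_conjTranspose_apply {n κ : Type*} [Fintype n] [Fintype κ] (K : κ → Matrix n n ℂ)
    (X : Matrix n n ℂ) (k l : n) :
    (∑ a, K a * X * (K a)ᴴ) k l = ∑ p, ∑ q, X p q * ∑ a, K a k p * star (K a l q) := by
  simp only [Matrix.sum_apply, Matrix.mul_apply, Finset.mul_sum, Finset.sum_mul,
    conjTranspose_apply]
  rw [Finset.sum_comm_cycle, Finset.sum_comm_cycle, Finset.sum_comm]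
  refine Finset.sum_congr rfl fun p _ => Finset.sum_congr rfl fun q _ =>
    Finset.sum_congr rfl fun a _ => by ring

/-- The Kraus operators of a TIO can be split according to the energy shifts `e k - e p` of their
matrix elements: by covariance the cross terms between different shifts cancel. All operators are
expressed in the eigenbasis `U` of the Hamiltonian. -/
lemma exists_covariantKraus_of_isTIO {U : Matrix n n ℂ} (hU : U * Uᴴ = 1) (e : n → ℝ)
    {E : Matrix n n ℂ →CP Matrix n n ℂ} (hE : IsTIO (U * diagonal (fun i => (e i : ℂ)) * Uᴴ) E) :
    ∃ (Ω : Finset ℝ) (K : (n × n) × Ω → Matrix n n ℂ),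
      IsCovariantKraus e (fun a => (a.2 : ℝ)) K ∧
        ∀ X, Uᴴ * E (U * X * Uᴴ) * U = ∑ a, K a * X * (K a)ᴴ := by
  have hU' : Uᴴ * U = 1 := mul_eq_one_comm.mp hU
  obtain ⟨L, hL⟩ := exists_kraus E
  let K₀ (i : n × n) : Matrix n n ℂ := Uᴴ * L i * U
  let F (X : Matrix n n ℂ) : Matrix n n ℂ := Uᴴ * E (U * X * Uᴴ) * U
  have hF (X : Matrix n n ℂ) : F X = ∑ i, K₀ i * X * (K₀ i)ᴴ := by
    simp only [F, K₀, hL, Finset.mul_sum, Finset.sum_mul, conjTranspose_mul,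
      conjTranspose_conjTranspose, Matrix.mul_assoc]
  -- `g p q k l` is the `(k, l)` entry of the image of the matrix unit `|p⟩⟨q|`.
  let g (p q k l : n) : ℂ := ∑ i, K₀ i k p * star (K₀ i l q)
  have hFg (X : Matrix n n ℂ) (k l : n) : F X k l = ∑ p, ∑ q, X p q * g p q k l := by
    rw [hF, sum_mul_mul_conjTranspose_apply]
  have hFs (p q k l : n) (z : ℂ) : F (single p q z) k l = z * g p q k l := by
    rw [hFg, Finset.sum_eq_single p, Finset.sum_eq_single q]
    · simp
    · intro b _ hb
      simp [hb.symm]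
    · simp
    · intro b _ hb
      simp [hb.symm]
    · simp
  have hcov (t : ℝ) (X : Matrix n n ℂ) :
      F (diagonal (fun i => Complex.exp (-(Complex.I * t) * e i)) * X *
          diagonal (fun i => Complex.exp (-(Complex.I * (-t : ℝ)) * e i))) =
        diagonal (fun i => Complex.exp (-(Complex.I * t) * e i)) * F X *
          diagonal (fun i => Complex.exp (-(Complex.I * (-t : ℝ)) * e i)) := by
    have h := hE.covariant t (U * X * Uᴴ)
    rw [timeEvolution_conj_diagonal hU, timeEvolution_conj_diagonal hU] at h
    generalize diagonal (fun i => Complex.exp (-(Complex.I * t) * e i)) = D at *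
    generalize diagonal (fun i => Complex.exp (-(Complex.I * (-t : ℝ)) * e i)) = D' at *
    have h1 : U * D * Uᴴ * (U * X * Uᴴ) * (U * D' * Uᴴ) = U * (D * X * D') * Uᴴ := by
      simp only [Matrix.mul_assoc]
      simp only [← Matrix.mul_assoc Uᴴ U, hU', Matrix.one_mul]
    rw [h1] at h
    simp only [F]
    rw [h]
    simp only [Matrix.mul_assoc]
    simp only [← Matrix.mul_assoc Uᴴ U, hU', Matrix.one_mul, Matrix.mul_one]
  have hg (p q k l : n) (hne : e k - e p ≠ e l - e q) : g p q k l = 0 := by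
    by_contra hg0
    let Δ : ℝ := (e p - e q) - (e k - e l)
    have hΔ : Δ ≠ 0 := fun h => hne (by simp only [Δ] at h; linarith)
    -- At time `π / Δ` the phases on the two sides differ by a factor `-1`.
    have h := congrFun (congrFun (hcov (Real.pi / Δ) (single p q 1)) k) l
    have hs (d d' : n → ℂ) :
        diagonal d * single p q (1 : ℂ) * diagonal d' = single p q (d p * d' q) := by
      ext i j
      rw [mul_diagonal, diagonal_mul]
      by_cases hij : p = i ∧ q = j
      · obtain ⟨rfl, rfl⟩ := hij
        simp
      · simp [single_apply_of_ne _ _ _ _ _ hij]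
    rw [hs, hFs, mul_diagonal, diagonal_mul, hFs] at h
    have h2 : Complex.exp (-(Complex.I * (Real.pi / Δ : ℝ)) * e p) *
        Complex.exp (-(Complex.I * (-(Real.pi / Δ) : ℝ)) * e q) =
        Complex.exp (-(Complex.I * (Real.pi / Δ : ℝ)) * e k) *
        Complex.exp (-(Complex.I * (-(Real.pi / Δ) : ℝ)) * e l) := by
      apply mul_right_cancel₀ hg0
      linear_combination h
    rw [← Complex.exp_add, ← Complex.exp_add] at h2
    have h3 : -(Complex.I * (Real.pi / Δ : ℝ)) * e p +
        -(Complex.I * (-(Real.pi / Δ) : ℝ)) * e q =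
        (-(Complex.I * (Real.pi / Δ : ℝ)) * e k + -(Complex.I * (-(Real.pi / Δ) : ℝ)) * e l)
          + -(Real.pi * Complex.I) := by
      have h4 : ((Real.pi / Δ * Δ : ℝ) : ℂ) = Real.pi := by rw [div_mul_cancel₀ _ hΔ]
      simp only [Δ] at h4 ⊢
      push_cast at h4 ⊢
      linear_combination -Complex.I * h4
    rw [h3, Complex.exp_add, Complex.exp_neg, Complex.exp_pi_mul_I] at h2
    have h5 := Complex.exp_ne_zero (-(Complex.I * (Real.pi / Δ : ℝ)) * e k +
      -(Complex.I * (-(Real.pi / Δ) : ℝ)) * e l)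
    apply h5
    linear_combination (-1 / 2 : ℂ) * h2
  let Ω : Finset ℝ := Finset.univ.image fun p : n × n => e p.1 - e p.2
  let K (a : (n × n) × Ω) : Matrix n n ℂ :=
    Matrix.of fun k p => if e k - e p = a.2 then K₀ a.1 k p else 0
  have hK (p q k l : n) : ∑ a, K a k p * star (K a l q) = g p q k l := by
    rw [Fintype.sum_prod_type]
    by_cases heq : e k - e p = e l - e q
    · refine Finset.sum_congr rfl fun i _ => ?_
      have hmem : e k - e p ∈ Ω := Finset.mem_image_of_mem _ (Finset.mem_univ (k, p))
      rw [Finset.sum_eq_single ⟨e k - e p, hmem⟩]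
      · simp [K, heq]
      · intro w _ hw
        have : e k - e p ≠ w := fun h => hw (Subtype.ext h.symm)
        simp [K, this]
      · simp
    · rw [hg p q k l heq]
      refine Finset.sum_eq_zero fun i _ => Finset.sum_eq_zero fun w _ => ?_
      by_cases hw : e k - e p = w
      · have : e l - e q ≠ w := fun h => heq (hw.trans h.symm)
        simp [K, this]
      · simp [K, hw]
  refine ⟨Ω, K, ⟨?_, fun a k p h => ?_⟩, fun X => ?_⟩
  · ext q p
    have htr : (F (single p q 1)).trace = (single p q (1 : ℂ)).trace := by
      rw [Matrix.trace_mul_cycle, hU, Matrix.one_mul, hE.trace_map, Matrix.trace_mul_cycle, hU',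
        Matrix.one_mul]
    have h1 : (∑ a, (K a)ᴴ * K a) q p = (F (single p q 1)).trace := by
      simp only [Matrix.trace, diag_apply, hFs, one_mul, ← hK, Matrix.sum_apply, Matrix.mul_apply,
        conjTranspose_apply]
      rw [Finset.sum_comm]
      simp only [mul_comm]
    rw [h1, htr]
    by_cases hpq : p = q
    · subst hpq
      simp
    · rw [Matrix.trace_single_eq_of_ne _ _ _ hpq, one_apply_ne' hpq]
  · by_contra hne
    exact h (by simp [K, hne])
  · ext k l
    rw [sum_mul_mul_conjTranspose_apply]
    simp only [hK]
    exact hFg X k l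

lemma exists_isTIO_of_covariantKraus {κ : Type*} [Fintype κ] {U : Matrix n n ℂ}
    (hU : U * Uᴴ = 1) {e : n → ℝ} {ω : κ → ℝ} {K : κ → Matrix n n ℂ}
    (hK : IsCovariantKraus e ω K) :
    ∃ E : Matrix n n ℂ →CP Matrix n n ℂ, IsTIO (U * diagonal (fun i => (e i : ℂ)) * Uᴴ) E ∧
      ∀ X, E (U * X * Uᴴ) = U * (∑ a, K a * X * (K a)ᴴ) * Uᴴ := by
  have hU' : Uᴴ * U = 1 := mul_eq_one_comm.mp hU
  obtain ⟨E, hE⟩ := exists_cpMap_of_kraus fun a => U * K a * Uᴴ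
  have hEU (X : Matrix n n ℂ) : E (U * X * Uᴴ) = U * (∑ a, K a * X * (K a)ᴴ) * Uᴴ := by
    rw [hE]
    simp only [Finset.mul_sum, Finset.sum_mul, conjTranspose_mul, conjTranspose_conjTranspose,
      Matrix.mul_assoc]
    simp only [← Matrix.mul_assoc Uᴴ U, hU', Matrix.one_mul]
  have hX (X : Matrix n n ℂ) : X = U * (Uᴴ * X * U) * Uᴴ := by
    simp only [Matrix.mul_assoc, hU, Matrix.mul_one]
    simp only [← Matrix.mul_assoc, hU, Matrix.one_mul]
  refine ⟨E, ⟨fun X => ?_, fun t X => ?_⟩, hEU⟩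
  · obtain ⟨Y, rfl⟩ : ∃ Y, X = U * Y * Uᴴ := ⟨_, hX X⟩
    rw [hEU, Matrix.trace_mul_cycle, Matrix.trace_mul_cycle U, hU', Matrix.one_mul, Matrix.one_mul,
      Matrix.trace_sum]
    have h1 (a : κ) : (K a * Y * (K a)ᴴ).trace = ((K a)ᴴ * K a * Y).trace :=
      Matrix.trace_mul_cycle _ _ _
    simp only [h1]
    rw [← Matrix.trace_sum, ← Finset.sum_mul, hK.sum_eq_one, Matrix.one_mul]
  · obtain ⟨Y, rfl⟩ : ∃ Y, X = U * Y * Uᴴ := ⟨_, hX X⟩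
    rw [timeEvolution_conj_diagonal hU, timeEvolution_conj_diagonal hU]
    let d (i : n) : ℂ := Complex.exp (-(Complex.I * t) * e i)
    let d' (i : n) : ℂ := Complex.exp (-(Complex.I * (-t : ℝ)) * e i)
    change E (U * diagonal d * Uᴴ * _ * (U * diagonal d' * Uᴴ)) =
      U * diagonal d * Uᴴ * _ * (U * diagonal d' * Uᴴ)
    have h1 (D Y D' : Matrix n n ℂ) :
        U * D * Uᴴ * (U * Y * Uᴴ) * (U * D' * Uᴴ) = U * (D * Y * D') * Uᴴ := by
      simp only [Matrix.mul_assoc]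
      simp only [← Matrix.mul_assoc Uᴴ U, hU', Matrix.one_mul]
    rw [h1, hEU, hEU, h1]
    congr 2
    rw [Finset.mul_sum, Finset.sum_mul]
    refine Finset.sum_congr rfl fun a _ => ?_
    have h2 : K a * diagonal d = Complex.exp (Complex.I * t * ω a) • (diagonal d * K a) := by
      ext k m
      rw [mul_diagonal, Matrix.smul_apply, diagonal_mul, smul_eq_mul]
      by_cases h0 : K a k m = 0
      · simp [h0]
      rw [← hK.mode a k m h0, ← mul_assoc, ← Complex.exp_add, mul_comm]
      congr 1
      simp only [d]
      congr 1
      push_cast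
      ring
    have h3 : diagonal d' * (K a)ᴴ =
        Complex.exp (-(Complex.I * t * ω a)) • ((K a)ᴴ * diagonal d') := by
      ext k m
      rw [diagonal_mul, Matrix.smul_apply, mul_diagonal, smul_eq_mul, conjTranspose_apply]
      by_cases h0 : K a m k = 0
      · simp [h0]
      rw [← hK.mode a m k h0, mul_comm (star _), ← mul_assoc, ← Complex.exp_add]
      congr 1
      simp only [d']
      congr 1
      push_cast
      ring
    calc K a * (diagonal d * Y * diagonal d') * (K a)ᴴ
        = (K a * diagonal d) * Y * (diagonal d' * (K a)ᴴ) := by simp only [Matrix.mul_assoc]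
      _ = diagonal d * (K a * Y * (K a)ᴴ) * diagonal d' := by
        rw [h2, h3]
        simp only [Matrix.smul_mul, Matrix.mul_smul, smul_smul, ← Complex.exp_add]
        simp [Matrix.mul_assoc]

end Covariance

/-! ### Spectral projections of a diagonal Hamiltonian -/

/-- The spectral projection of the Hamiltonian `diagonal e` for the energy `x`; it is zero if `x` is
not an energy level. -/
noncomputable def levelProj {n : Type*} [DecidableEq n] (e : n → ℝ) (x : ℝ) : Matrix n n ℂ :=
  diagonal fun i => if e i = x then 1 else 0

section LevelProj

variable {n r : Type*} [DecidableEq n] (e : n → ℝ) (x : ℝ)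

lemma levelProj_mul_apply [Fintype n] (A : Matrix n r ℂ) (k : n) (i : r) :
    (levelProj e x * A) k i = if e k = x then A k i else 0 := by
  simp [levelProj, diagonal_mul]

lemma levelProj_conjTranspose : (levelProj e x)ᴴ = levelProj e x := by
  rw [levelProj, diagonal_conjTranspose]
  congr 1
  ext i
  by_cases h : e i = x <;> simp [h]

lemma levelProj_mul_self [Fintype n] : levelProj e x * levelProj e x = levelProj e x := by
  rw [levelProj, diagonal_mul_diagonal]
  congr 1
  ext i
  by_cases h : e i = x <;> simp [h]

lemma levelProj_gram [Fintype n] (A : Matrix n r ℂ) :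
    (levelProj e x * A)ᴴ * (levelProj e x * A) = Aᴴ * levelProj e x * A := by
  rw [conjTranspose_mul, levelProj_conjTranspose, Matrix.mul_assoc, ← Matrix.mul_assoc _ _ A,
    levelProj_mul_self, Matrix.mul_assoc]

lemma IsCovariantKraus.sum_levelProj [Fintype n] {κ : Type*} [Fintype κ] {e : n → ℝ} {ω : κ → ℝ}
    {K : κ → Matrix n n ℂ} (hK : IsCovariantKraus e ω K) (x : ℝ) :
    ∑ a, (K a)ᴴ * levelProj e (x + ω a) * K a = levelProj e x := by
  have h (a : κ) : levelProj e (x + ω a) * K a = K a * levelProj e x := by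
    ext k m
    rw [levelProj_mul_apply, levelProj, mul_diagonal]
    by_cases h0 : K a k m = 0
    · simp [h0]
    have := hK.mode a k m h0
    have hiff : e k = x + ω a ↔ e m = x := by constructor <;> intro <;> linarith
    simp [hiff]
  simp only [Matrix.mul_assoc, h]
  simp only [← Matrix.mul_assoc]
  rw [← Matrix.sum_mul, hK.sum_eq_one, Matrix.one_mul]

end LevelProj

/-! ### Vanishing criteria -/

lemma eq_zero_of_sum_conjTranspose_mul_self_eq_zero {κ m n : Type*} [Fintype κ] [Fintype m]
    [Fintype n] {M : κ → Matrix m n ℂ} (h : ∑ a, (M a)ᴴ * M a = 0) (a : κ) : M a = 0 := by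
  ext i j
  have h1 : ∑ a, ∑ i, Complex.normSq (M a i j) = 0 := by
    have := congrFun (congrFun h j) j
    simp only [Matrix.sum_apply, Matrix.mul_apply, conjTranspose_apply, Complex.star_def,
      ← Complex.normSq_eq_conj_mul_self, Matrix.zero_apply] at this
    exact_mod_cast this
  rw [Finset.sum_eq_zero_iff_of_nonneg
    fun _ _ => Finset.sum_nonneg fun _ _ => Complex.normSq_nonneg _] at h1
  have h2 := h1 a (Finset.mem_univ a)
  rw [Finset.sum_eq_zero_iff_of_nonneg fun _ _ => Complex.normSq_nonneg _] at h2
  exact Complex.normSq_eq_zero.mp (h2 i (Finset.mem_univ i))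

/-- Convolution with a nonzero nonnegative measure of finite support is injective on functions of
finite support. -/
lemma eq_zero_of_sum_translates_eq_zero {c : Type*} [Fintype c] {w : c → ℝ} (hw : ∀ j, 0 ≤ w j)
    (hw' : ∃ j, w j ≠ 0) (μ : c → ℝ) {f : ℝ → ℂ} (hf : f.support.Finite)
    (h : ∀ x, ∑ j, (w j : ℂ) * f (x - μ j) = 0) : f = 0 := by
  by_contra hne
  have hsupp : f.support.Nonempty := Function.support_nonempty_iff.mpr hne
  obtain ⟨x₀, hx₀, hmax⟩ := Set.exists_max_image f.support id hf hsupp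
  obtain ⟨j₁, hj₁⟩ := hw'
  obtain ⟨j₀, hj₀, hjmax⟩ := Finset.exists_max_image (Finset.univ.filter fun j => w j ≠ 0) μ
    ⟨j₁, by simpa using hj₁⟩
  -- With `x₀` maximal in the support of `f` and `μ j₀` maximal where `w ≠ 0`, at
  -- `x₀ + μ j₀` only the translates with `μ j = μ j₀` contribute.
  have hterm (j : c) : (w j : ℂ) * f (x₀ + μ j₀ - μ j) =
      ((if μ j = μ j₀ then w j else 0 : ℝ) : ℂ) * f x₀ := by
    by_cases hj : w j = 0
    · simp [hj]
    rcases (hjmax j (by simpa using hj)).lt_or_eq with hlt | heq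
    · have : f (x₀ + μ j₀ - μ j) = 0 := by
        by_contra hne
        have := hmax _ hne
        simp only [id] at this
        linarith
      simp [this, hlt.ne]
    · simp [heq]
  have h0 := h (x₀ + μ j₀)
  simp only [hterm] at h0
  rw [← Finset.sum_mul, mul_eq_zero, ← Complex.ofReal_sum, Complex.ofReal_eq_zero,
    Finset.sum_eq_zero_iff_of_nonneg (fun j _ => by split_ifs <;> simp [hw])] at h0
  rcases h0 with h0 | h0
  · exact (Finset.mem_filter.mp hj₀).2 (by simpa using h0 j₀ (Finset.mem_univ _))
  · exact hx₀ h0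

/-! ### Eliminating a catalyst in a pure state -/

section Catalyst

variable {s c : Type*} [DecidableEq s]

/-- The matrix of the linear map `v ↦ v ⊗ φ`. -/
noncomputable def appendVec (φ : c → ℂ) : Matrix (s × c) s ℂ :=
  Matrix.of fun x i => if x.1 = i then φ x.2 else 0

lemma appendVec_mul_apply [Fintype s] {r : Type*} (φ : c → ℂ) (X : Matrix s r ℂ) (x : s × c)
    (i : r) :
    ((appendVec φ : Matrix (s × c) s ℂ) * X) x i = φ x.2 * X x.1 i := by
  simp [appendVec, Matrix.mul_apply]

lemma appendVec_mul_mul_conjTranspose [Fintype s] (φ : c → ℂ) (X : Matrix s s ℂ) :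
    (appendVec φ : Matrix (s × c) s ℂ) * X * (appendVec φ : Matrix (s × c) s ℂ)ᴴ =
      kronecker X (vecMulVec φ (star φ)) := by
  ext x y
  rw [Matrix.mul_apply]
  simp only [appendVec_mul_apply]
  rw [Finset.sum_eq_single y.1 (fun b _ hb => by simp [appendVec, hb.symm]) (by simp)]
  simp [appendVec, vecMulVec_apply]
  ring

lemma appendVec_conjTranspose_mul_levelProj_mul [Fintype s] [Fintype c] [DecidableEq c]
    (φ : c → ℂ) (e : s → ℝ) (μ : c → ℝ) (x : ℝ) :
    (appendVec φ : Matrix (s × c) s ℂ)ᴴ * levelProj (fun y : s × c => e y.1 + μ y.2) x *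
        (appendVec φ : Matrix (s × c) s ℂ) =
      ∑ j, (Complex.normSq (φ j) : ℂ) • levelProj e (x - μ j) := by
  ext i i'
  rw [Matrix.mul_assoc, Matrix.mul_apply, Fintype.sum_prod_type]
  simp only [levelProj_mul_apply, appendVec, conjTranspose_apply, Matrix.of_apply,
    Matrix.sum_apply, Matrix.smul_apply]
  rw [Finset.sum_eq_single i (fun b _ hb => by simp [hb]) (by simp)]
  refine Finset.sum_congr rfl fun j _ => ?_
  by_cases hii : i = i'
  · subst hii
    simp [levelProj, eq_sub_iff_add_eq, Complex.normSq_eq_conj_mul_self]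
  · simp [levelProj, hii]

lemma appendVec_conjTranspose_mul_self [Fintype s] [Fintype c] [DecidableEq c]
    {φ : c → ℂ} (hφ : ∑ j, Complex.normSq (φ j) = 1) :
    (appendVec φ : Matrix (s × c) s ℂ)ᴴ * (appendVec φ : Matrix (s × c) s ℂ) =
      (1 : Matrix s s ℂ) := by
  have h := appendVec_conjTranspose_mul_levelProj_mul φ (0 : s → ℝ) (0 : c → ℝ) 0
  have h1 : levelProj (0 : s → ℝ) 0 = 1 := by simp [levelProj]
  have h2 : levelProj (fun y : s × c => (0 : s → ℝ) y.1 + (0 : c → ℝ) y.2) 0 = 1 := by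
    simp [levelProj]
  rw [h2, Matrix.mul_one] at h
  simp only [Pi.zero_apply, sub_zero, h1] at h
  rw [h, ← Finset.sum_smul, ← Complex.ofReal_sum, hφ]
  simp

/-- If a covariant operation of the composite system takes `A Aᴴ ⊗ |φ⟩⟨φ|` to `ρ' ⊗ |φ⟩⟨φ|`, then
`ρ' = ∑ a, B a (B a)ᴴ` where the `B a`, with energies shifted back by `ω a`, have jointly the same
energy-resolved Gram matrices as `A`. No reference to the catalyst is left in the conclusion. -/
lemma IsCovariantKraus.exists_gram_eq [Fintype s] [Fintype c] [DecidableEq c]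
    {κ : Type*} [Fintype κ] {e : s → ℝ} {μ : c → ℝ} {ω : κ → ℝ}
    {K : κ → Matrix (s × c) (s × c) ℂ}
    (hK : IsCovariantKraus (fun y : s × c => e y.1 + μ y.2) ω K)
    {φ : c → ℂ} (hφ : ∑ j, Complex.normSq (φ j) = 1) {A ρ' : Matrix s s ℂ}
    (h : ∑ a, K a * kronecker (A * Aᴴ) (vecMulVec φ (star φ)) * (K a)ᴴ =
      kronecker ρ' (vecMulVec φ (star φ))) :
    ∃ B : κ → Matrix s s ℂ, ∑ a, B a * (B a)ᴴ = ρ' ∧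
      ∀ x, (levelProj e x * A)ᴴ * (levelProj e x * A) =
        ∑ a, (levelProj e (x + ω a) * B a)ᴴ * (levelProj e (x + ω a) * B a) := by
  have hΦ := appendVec_conjTranspose_mul_self (s := s) hφ
  rw [← appendVec_mul_mul_conjTranspose, ← appendVec_mul_mul_conjTranspose] at h
  have hR := appendVec_conjTranspose_mul_levelProj_mul φ e μ
  generalize hΦdef : (appendVec φ : Matrix (s × c) s ℂ) = Φ at *
  -- `Q` projects onto the vectors whose second factor is orthogonal to `φ`.
  let Q : Matrix (s × c) (s × c) ℂ := 1 - Φ * Φᴴ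
  have hQΦ : Q * Φ = 0 := by
    simp [Q, Matrix.sub_mul, Matrix.mul_assoc, hΦ]
  let Y (a : κ) : Matrix (s × c) s ℂ := K a * Φ * A
  have hY : ∑ a, Y a * (Y a)ᴴ = Φ * ρ' * Φᴴ := by
    rw [← h]
    simp only [Y, conjTranspose_mul, Matrix.mul_assoc]
  have hQY (a : κ) : Q * Y a = 0 := by
    have h1 : ∑ a, ((Q * Y a)ᴴ)ᴴ * (Q * Y a)ᴴ = 0 := by
      have : ∑ a, ((Q * Y a)ᴴ)ᴴ * (Q * Y a)ᴴ = Q * (∑ a, Y a * (Y a)ᴴ) * Qᴴ := by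
        simp only [conjTranspose_mul, conjTranspose_conjTranspose, Matrix.mul_assoc,
          Matrix.mul_sum, Matrix.sum_mul]
      rw [this, hY, ← Matrix.mul_assoc, ← Matrix.mul_assoc, hQΦ]
      simp
    exact conjTranspose_eq_zero.mp (eq_zero_of_sum_conjTranspose_mul_self_eq_zero h1 a)
  let B (a : κ) : Matrix s s ℂ := Φᴴ * Y a
  have hYB (a : κ) : Y a = Φ * B a := by
    have := hQY a
    simp only [Q, Matrix.sub_mul, Matrix.one_mul, sub_eq_zero] at this
    rw [this]
    simp only [B, Matrix.mul_assoc]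
  refine ⟨B, ?_, ?_⟩
  · have : ∑ a, B a * (B a)ᴴ = Φᴴ * (∑ a, Y a * (Y a)ᴴ) * Φ := by
      simp only [B, conjTranspose_mul, conjTranspose_conjTranspose, Matrix.mul_assoc,
        Matrix.mul_sum, Matrix.sum_mul]
    rw [this, hY]
    simp only [Matrix.mul_assoc, hΦ, Matrix.mul_one]
    rw [← Matrix.mul_assoc, hΦ, Matrix.one_mul]
  simp only [levelProj_gram]
  let D (x : ℝ) : Matrix s s ℂ := Aᴴ * levelProj e x * A -
    ∑ a, (B a)ᴴ * levelProj e (x + ω a) * B a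
  have hsum (x : ℝ) : ∑ j, (Complex.normSq (φ j) : ℂ) • D (x - μ j) = 0 := by
    -- Sandwich the energy conservation law between the columns of `A ⊗ φ`.
    have h1 := congrArg (fun M => Aᴴ * (Φᴴ * M * Φ) * A) (hK.sum_levelProj x)
    have h2 : Aᴴ * (Φᴴ * (∑ a, (K a)ᴴ * levelProj (fun y : s × c => e y.1 + μ y.2) (x + ω a) *
        K a) * Φ) * A =
        ∑ a, (B a)ᴴ * (Φᴴ * levelProj (fun y : s × c => e y.1 + μ y.2) (x + ω a) * Φ) * B a := by
      simp only [Matrix.mul_sum, Matrix.sum_mul]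
      refine Finset.sum_congr rfl fun a _ => ?_
      calc _ = (Y a)ᴴ * levelProj (fun y : s × c => e y.1 + μ y.2) (x + ω a) * Y a := by
            simp only [Y, conjTranspose_mul, Matrix.mul_assoc]
        _ = _ := by
            rw [hYB]
            simp only [conjTranspose_mul, Matrix.mul_assoc]
    simp only [h2, hR] at h1
    simp only [D, smul_sub, Finset.sum_sub_distrib, sub_eq_zero]
    simp only [Matrix.mul_sum, Matrix.sum_mul, Matrix.mul_smul, Matrix.smul_mul,
      Finset.smul_sum] at h1 ⊢
    rw [← h1, Finset.sum_comm]
    refine Finset.sum_congr rfl fun a _ => Finset.sum_congr rfl fun j _ => ?_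
    rw [sub_add_eq_add_sub]
  have hlevel (x : ℝ) (hx : x ∉ Set.range e) : levelProj e x = 0 := by
    ext i j
    have : e i ≠ x := fun h => hx ⟨i, h⟩
    simp [levelProj, diagonal_apply, this]
  have hfin : (Set.range e ∪ ⋃ a, Set.range fun i => e i - ω a).Finite :=
    (Set.finite_range e).union (Set.finite_iUnion fun a => Set.finite_range _)
  have hD (x : ℝ) (hx : x ∉ Set.range e ∪ ⋃ a, Set.range fun i => e i - ω a) : D x = 0 := by
    simp only [Set.mem_union, Set.mem_iUnion, not_or, not_exists] at hx
    have h2 (a : κ) : x + ω a ∉ Set.range e := by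
      rintro ⟨i, hi⟩
      exact hx.2 a ⟨i, by simp [hi]⟩
    simp [D, hlevel _ hx.1, hlevel _ (h2 _)]
  intro x
  rw [← sub_eq_zero]
  change D x = 0
  ext i j
  have h0 : (fun x => D x i j) = 0 := by
    refine eq_zero_of_sum_translates_eq_zero (w := fun j => Complex.normSq (φ j))
      (fun j => Complex.normSq_nonneg _) ?_ μ (hfin.subset fun x hx => ?_) fun x => ?_
    · by_contra! hall
      simp [hall] at hφ
    · by_contra hx'
      exact hx (by simp [hD x hx'])
    · have := congrFun (congrFun (hsum x) i) j
      simpa [Matrix.sum_apply] using this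
  exact congrFun h0 x

end Catalyst

/-! ### Covariant extension of a map preserving Gram matrices -/

section GramExtension

open scoped ComplexOrder in
/-- A weak form of the Moore–Penrose inverse: `A * Z` is the orthogonal projection onto the column
space of `A`. -/
lemma exists_generalizedInverse {n r : Type*} [Fintype n] [Fintype r] [DecidableEq r]
    (A : Matrix n r ℂ) : ∃ Z : Matrix r n ℂ, A * Z * A = A ∧ (A * Z)ᴴ = A * Z := by
  have hG : (Aᴴ * A).IsHermitian := isHermitian_conjTranspose_mul_self A
  let U : Matrix r r ℂ := hG.eigenvectorUnitary
  have hU : Uᴴ * U = 1 := by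
    simpa [U, star_eq_conjTranspose] using Unitary.coe_star_mul_self hG.eigenvectorUnitary
  let d (i : r) : ℂ := hG.eigenvalues i
  have hspec : Aᴴ * A = U * diagonal d * Uᴴ := by
    have := hG.spectral_theorem
    rw [Unitary.conjStarAlgAut_apply] at this
    exact this
  -- As `0⁻¹ = 0`, this is the pseudo-inverse of `Aᴴ * A`.
  let P : Matrix r r ℂ := U * diagonal (fun i => (d i)⁻¹) * Uᴴ
  have hP : Pᴴ = P := by
    have : star (fun i => (d i)⁻¹) = fun i => (d i)⁻¹ := by
      ext i
      simp [d]
    simp only [P, conjTranspose_mul, conjTranspose_conjTranspose, diagonal_conjTranspose, this,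
      Matrix.mul_assoc]
  have hGPG : Aᴴ * A * P * (Aᴴ * A) = Aᴴ * A := by
    rw [hspec]
    have h1 : diagonal d * (diagonal (fun i => (d i)⁻¹) * diagonal d) = diagonal d := by
      rw [diagonal_mul_diagonal, diagonal_mul_diagonal]
      congr 1
      ext i
      by_cases h : d i = 0 <;> simp [h]
    calc U * diagonal d * Uᴴ * P * (U * diagonal d * Uᴴ)
        = U * diagonal d * (Uᴴ * U) * diagonal (fun i => (d i)⁻¹) * (Uᴴ * U) *
            diagonal d * Uᴴ := by simp only [P, Matrix.mul_assoc]
      _ = U * (diagonal d * (diagonal (fun i => (d i)⁻¹) * diagonal d)) * Uᴴ := by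
          simp only [hU, Matrix.mul_one, Matrix.mul_assoc]
      _ = _ := by rw [h1]
  refine ⟨P * Aᴴ, ?_, ?_⟩
  · rw [← sub_eq_zero, ← conjTranspose_mul_self_eq_zero]
    have h2 : (A * (P * Aᴴ) * A - A)ᴴ = Aᴴ * A * P * Aᴴ - Aᴴ := by
      simp only [conjTranspose_sub, conjTranspose_mul, conjTranspose_conjTranspose, hP,
        Matrix.mul_assoc]
    have h3 : (A * (P * Aᴴ) * A - A)ᴴ * A = 0 := by
      rw [h2, Matrix.sub_mul, Matrix.mul_assoc _ Aᴴ A, hGPG, sub_self]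
    rw [Matrix.mul_sub, ← Matrix.mul_assoc, ← Matrix.mul_assoc, h3]
    simp
  · simp only [conjTranspose_mul, conjTranspose_conjTranspose, hP, Matrix.mul_assoc]

/-- If `A` and the stack of all `B a` have equal Gram matrices, then the operators `B a * Z` form a
partial isometry which takes `A` to that stack and has initial projection `A * Z`. -/
lemma exists_factor_of_gram_eq {κ m n r : Type*} [Fintype κ] [Fintype m] [Fintype n] [Fintype r]
    [DecidableEq r] {A : Matrix n r ℂ} {B : κ → Matrix m r ℂ}
    (h : Aᴴ * A = ∑ a, (B a)ᴴ * B a) :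
    ∃ Z : Matrix r n ℂ, A * Z * A = A ∧ (A * Z)ᴴ = A * Z ∧ (∀ a, B a * Z * A = B a) ∧
      ∑ a, (B a * Z)ᴴ * (B a * Z) = A * Z := by
  obtain ⟨Z, hZ, hZ'⟩ := exists_generalizedInverse A
  refine ⟨Z, hZ, hZ', fun a => ?_, ?_⟩
  · have h1 : ∑ a, (B a * (Z * A - 1))ᴴ * (B a * (Z * A - 1)) = 0 := by
      have : ∑ a, (B a * (Z * A - 1))ᴴ * (B a * (Z * A - 1)) =
          (Z * A - 1)ᴴ * (∑ a, (B a)ᴴ * B a) * (Z * A - 1) := by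
        simp only [Matrix.mul_sum, Matrix.sum_mul, conjTranspose_mul, Matrix.mul_assoc]
      rw [this, ← h, Matrix.mul_assoc, Matrix.mul_assoc Aᴴ, Matrix.mul_sub A, ← Matrix.mul_assoc A,
        hZ]
      simp
    have := eq_zero_of_sum_conjTranspose_mul_self_eq_zero h1 a
    rwa [Matrix.mul_sub, Matrix.mul_one, sub_eq_zero, ← Matrix.mul_assoc] at this
  · calc ∑ a, (B a * Z)ᴴ * (B a * Z) = Zᴴ * (∑ a, (B a)ᴴ * B a) * Z := by
          simp only [Matrix.mul_sum, Matrix.sum_mul, conjTranspose_mul, Matrix.mul_assoc]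
      _ = (A * Z)ᴴ * (A * Z) := by
          rw [← h]
          simp only [conjTranspose_mul, Matrix.mul_assoc]
      _ = A * Z := by rw [hZ', ← Matrix.mul_assoc, hZ]

/-- The partial isometries at the individual energy levels, glued together and completed by the
projection `V none` onto the complement of their initial spaces, form a covariant family that takes
`A` to `B`. -/
lemma exists_covariantKraus_of_gram_eq {κ n r : Type*} [Fintype κ] [Fintype n] [DecidableEq n]
    [Fintype r] [DecidableEq r] {e : n → ℝ} {ω : κ → ℝ} {A : Matrix n r ℂ} {B : κ → Matrix n r ℂ}
    (h : ∀ x, (levelProj e x * A)ᴴ * (levelProj e x * A) =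
      ∑ a, (levelProj e (x + ω a) * B a)ᴴ * (levelProj e (x + ω a) * B a)) :
    ∃ V : Option κ → Matrix n n ℂ, IsCovariantKraus e (fun o => o.elim 0 ω) V ∧
      V none * A = 0 ∧ ∀ a, V (some a) * A = B a := by
  choose Z hZ hQH hCA hQ using fun x => exists_factor_of_gram_eq (h x)
  let C (x : ℝ) (a : κ) : Matrix n n ℂ := levelProj e (x + ω a) * B a * Z x
  let Q (x : ℝ) : Matrix n n ℂ := levelProj e x * A * Z x
  have hQH' (x : ℝ) (k m : n) : star (Q x m k) = Q x k m := congrFun (congrFun (hQH x) k) m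
  have hQQ (x : ℝ) : Q x * Q x = Q x := by
    simp only [Q]
    rw [← Matrix.mul_assoc, hZ]
  have hQ_left (x : ℝ) (k m : n) (hk : e k ≠ x) : Q x k m = 0 := by
    simp only [Q, Matrix.mul_assoc, levelProj_mul_apply, hk, if_false]
  have hQ_right (x : ℝ) (k m : n) (hm : e m ≠ x) : Q x k m = 0 := by
    rw [← hQH', hQ_left x m k hm, star_zero]
  have hC_left (x : ℝ) (a : κ) (k m : n) (hk : e k ≠ x + ω a) : C x a k m = 0 := by
    simp only [C, Matrix.mul_assoc, levelProj_mul_apply, hk, if_false]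
  -- Column `m` of the glued operators is taken from the level `e m` to which `m` belongs.
  let W : Matrix n n ℂ := Matrix.of fun k m => Q (e m) k m
  let V (a : κ) : Matrix n n ℂ := Matrix.of fun k m => C (e m) a k m
  have hWH : Wᴴ = W := by
    ext k m
    simp only [W, conjTranspose_apply, Matrix.of_apply, hQH']
    by_cases hkm : e k = e m
    · rw [hkm]
    · rw [hQ_right _ _ _ (Ne.symm hkm), hQ_left _ _ _ hkm]
  have hWW : W * W = W := by
    ext k m
    conv_rhs => simp only [W, Matrix.of_apply]; rw [← hQQ]
    simp only [Matrix.mul_apply, W, Matrix.of_apply]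
    refine Finset.sum_congr rfl fun l _ => ?_
    by_cases hlm : e l = e m
    · rw [hlm]
    · rw [hQ_left _ l m hlm, mul_zero, mul_zero]
  have hWA : W * A = A := by
    ext k i
    have h1 : A k i = (Q (e k) * (levelProj e (e k) * A)) k i := by
      simp only [Q]
      rw [hZ, levelProj_mul_apply, if_pos rfl]
    rw [h1, Matrix.mul_apply, Matrix.mul_apply]
    refine Finset.sum_congr rfl fun m _ => ?_
    rw [levelProj_mul_apply]
    by_cases hkm : e m = e k
    · simp [W, hkm]
    · simp [W, hkm, hQ_left _ k m (Ne.symm hkm)]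
  have hVA (a : κ) : V a * A = B a := by
    ext k i
    -- Row `k` of `V a` only involves the level `x` that `ω a` shifts to `e k`.
    let x := e k - ω a
    have hx : e k = x + ω a := by simp [x]
    have h1 : B a k i = (C x a * (levelProj e x * A)) k i := by
      simp only [C]
      rw [hCA, levelProj_mul_apply, if_pos hx]
    rw [h1, Matrix.mul_apply, Matrix.mul_apply]
    refine Finset.sum_congr rfl fun m _ => ?_
    rw [levelProj_mul_apply]
    by_cases hm : e m = x
    · simp [V, hm]
    · have : C (e m) a k m = 0 := hC_left _ _ _ _ fun h => hm (by linarith)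
      simp [V, hm, this]
  have hVV : ∑ a, (V a)ᴴ * V a = W := by
    ext k m
    by_cases hkm : e k = e m
    · have h1 : W k m = (∑ a, (C (e m) a)ᴴ * C (e m) a) k m := by
        simp only [C]
        rw [hQ]
        rfl
      rw [h1]
      simp only [Matrix.sum_apply, Matrix.mul_apply, conjTranspose_apply, V, Matrix.of_apply, hkm]
    · simp only [Matrix.sum_apply, Matrix.mul_apply, conjTranspose_apply, V, W, Matrix.of_apply]
      rw [hQ_left _ _ _ hkm]
      refine Finset.sum_eq_zero fun a _ => Finset.sum_eq_zero fun l _ => ?_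
      by_cases hl : e l = e m + ω a
      · rw [hC_left (e k) a l k fun h => hkm (by linarith), star_zero, zero_mul]
      · rw [hC_left (e m) a l m hl, mul_zero]
  refine ⟨fun o => o.elim (1 - W) V, ⟨?_, ?_⟩, ?_, hVA⟩
  · rw [Fintype.sum_option]
    simp only [Option.elim]
    rw [hVV, conjTranspose_sub, hWH, conjTranspose_one, Matrix.sub_mul, Matrix.mul_sub,
      Matrix.mul_sub, hWW]
    simp
  · rintro (_ | a) k m hne
    · simp only [Option.elim] at hne ⊢
      by_contra hkm
      apply hne
      have hkm' : e k ≠ e m := fun h => hkm (by linarith)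
      have hkm'' : k ≠ m := fun h => hkm' (by rw [h])
      simp [W, hkm'', hQ_left _ _ _ hkm']
    · simp only [Option.elim] at hne ⊢
      by_contra hkm
      exact hne (hC_left _ _ _ _ fun h => hkm (by linarith))
  · simp only [Option.elim]
    rw [Matrix.sub_mul, hWA, Matrix.one_mul, sub_self]

end GramExtension

/-! ### Diagonalization and conclusion -/

open scoped Kronecker

section Diagonalization

lemma Matrix.IsHermitian.exists_diagonalization {n : Type*} [Fintype n] [DecidableEq n]
    {H : Matrix n n ℂ} (hH : H.IsHermitian) :
    ∃ (U : Matrix n n ℂ) (e : n → ℝ), U * Uᴴ = 1 ∧ H = U * diagonal (fun i => (e i : ℂ)) * Uᴴ := by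
  refine ⟨hH.eigenvectorUnitary, hH.eigenvalues, ?_, ?_⟩
  · simpa [star_eq_conjTranspose] using Unitary.coe_mul_star_self hH.eigenvectorUnitary
  · have := hH.spectral_theorem
    rw [Unitary.conjStarAlgAut_apply] at this
    exact this

variable {s c : Type*} [Fintype s] [DecidableEq s] [Fintype c] [DecidableEq c]

lemma totalHamiltonian_conj_diagonal {U : Matrix s s ℂ} {W : Matrix c c ℂ} (hU : U * Uᴴ = 1)
    (hW : W * Wᴴ = 1) (e : s → ℝ) (μ : c → ℝ) :
    totalHamiltonian (U * diagonal (fun i => (e i : ℂ)) * Uᴴ)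
        (W * diagonal (fun j => (μ j : ℂ)) * Wᴴ) =
      (U ⊗ₖ W) * diagonal (fun y : s × c => ((e y.1 + μ y.2 : ℝ) : ℂ)) * (U ⊗ₖ W)ᴴ := by
  have hD : diagonal (fun y : s × c => ((e y.1 + μ y.2 : ℝ) : ℂ)) =
      diagonal (fun i => (e i : ℂ)) ⊗ₖ (1 : Matrix c c ℂ) +
        (1 : Matrix s s ℂ) ⊗ₖ diagonal (fun j => (μ j : ℂ)) := by
    rw [← diagonal_one, ← diagonal_one, diagonal_kronecker_diagonal, diagonal_kronecker_diagonal,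
      diagonal_add]
    simp
  rw [hD, conjTranspose_kronecker, Matrix.mul_add, Matrix.add_mul, ← mul_kronecker_mul,
    ← mul_kronecker_mul, ← mul_kronecker_mul, ← mul_kronecker_mul, Matrix.mul_one, Matrix.mul_one,
    hU, hW]
  rfl

end Diagonalization

theorem theorem1 {s : Type*} [Fintype s] [DecidableEq s]
    (HS : Matrix s s ℂ) (hHS : HS.IsHermitian)
    (ρ ρ' : Matrix s s ℂ) (hρ : IsDensityMatrix ρ) (hρ' : IsDensityMatrix ρ')
    (hnot : ¬ TIOConvertible HS ρ ρ')
    {c : Type*} [Fintype c] [DecidableEq c]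
    (HC : Matrix c c ℂ) (hHC : HC.IsHermitian)
    (φ : EuclideanSpace ℂ c) (hφ : ‖φ‖ = 1) :
    ¬ TIOConvertible (totalHamiltonian HS HC)
        (Matrix.kronecker ρ (ketBra φ)) (Matrix.kronecker ρ' (ketBra φ)) := by
  rintro ⟨E, hE, hEρ⟩
  refine hnot ?_
  obtain ⟨U, e, hU, rfl⟩ := hHS.exists_diagonalization
  obtain ⟨W, μ, hW, rfl⟩ := hHC.exists_diagonalization
  have hU' : Uᴴ * U = 1 := mul_eq_one_comm.mp hU
  have hW' : Wᴴ * W = 1 := mul_eq_one_comm.mp hW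
  rw [totalHamiltonian_conj_diagonal hU hW] at hE
  have hUW : (U ⊗ₖ W) * (U ⊗ₖ W)ᴴ = 1 := by
    rw [conjTranspose_kronecker, ← mul_kronecker_mul, hU, hW, one_kronecker_one]
  obtain ⟨Ω, K, hK, hEK⟩ := exists_covariantKraus_of_isTIO hUW _ hE
  -- The catalyst state in the eigenbasis of its Hamiltonian.
  let ψ : c → ℂ := Wᴴ *ᵥ φ.ofLp
  have hψ : vecMulVec ψ (star ψ) = Wᴴ * ketBra φ * W := by
    rw [ketBra, mul_vecMulVec, vecMulVec_mul, star_mulVec, conjTranspose_conjTranspose]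
  have hψ_norm : ∑ j, Complex.normSq (ψ j) = 1 := by
    have h1 : star ψ ⬝ᵥ ψ = star φ.ofLp ⬝ᵥ φ.ofLp := by
      rw [star_mulVec, conjTranspose_conjTranspose, ← dotProduct_mulVec, mulVec_mulVec, hW,
        one_mulVec]
    have h2 : star φ.ofLp ⬝ᵥ φ.ofLp = 1 := by
      have := inner_self_eq_norm_sq_to_K (𝕜 := ℂ) φ
      rw [hφ, EuclideanSpace.inner_eq_star_dotProduct, dotProduct_comm] at this
      simpa using this
    rw [h2] at h1
    simp only [dotProduct, Pi.star_apply, Complex.star_def,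
      ← Complex.normSq_eq_conj_mul_self] at h1
    exact_mod_cast h1
  obtain ⟨A, hA⟩ : ∃ A : Matrix s s ℂ, Uᴴ * ρ * U = A * Aᴴ := by
    open scoped ComplexOrder MatrixOrder in
    have hpos := (hρ.posSemidef.conjTranspose_mul_mul_same U).nonneg
    obtain ⟨R, hR⟩ := CStarAlgebra.nonneg_iff_eq_star_mul_self.mp hpos
    exact ⟨Rᴴ, by rw [hR, conjTranspose_conjTranspose, star_eq_conjTranspose]⟩
  have hconj (σ : Matrix s s ℂ) : (Uᴴ * σ * U) ⊗ₖ vecMulVec ψ (star ψ) =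
      (U ⊗ₖ W)ᴴ * (σ ⊗ₖ ketBra φ) * (U ⊗ₖ W) := by
    rw [hψ, conjTranspose_kronecker, ← mul_kronecker_mul, ← mul_kronecker_mul]
  have hsum : ∑ a, K a * kronecker (A * Aᴴ) (vecMulVec ψ (star ψ)) * (K a)ᴴ =
      kronecker (Uᴴ * ρ' * U) (vecMulVec ψ (star ψ)) := by
    rw [← hEK, ← hA]
    change _ * E (_ * ((Uᴴ * ρ * U) ⊗ₖ vecMulVec ψ (star ψ)) * _) * _ =
      (Uᴴ * ρ' * U) ⊗ₖ vecMulVec ψ (star ψ)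
    rw [hconj, hconj]
    have : (U ⊗ₖ W) * ((U ⊗ₖ W)ᴴ * (ρ ⊗ₖ ketBra φ) * (U ⊗ₖ W)) * (U ⊗ₖ W)ᴴ = ρ ⊗ₖ ketBra φ := by
      simp only [Matrix.mul_assoc, hUW, Matrix.mul_one]
      rw [← Matrix.mul_assoc, hUW, Matrix.one_mul]
    rw [this]
    exact congrArg (fun M => (U ⊗ₖ W)ᴴ * M * (U ⊗ₖ W)) hEρ
  obtain ⟨B, hBρ', hB⟩ := hK.exists_gram_eq hψ_norm hsum
  obtain ⟨V, hV, hV_none, hV_some⟩ := exists_covariantKraus_of_gram_eq hB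
  obtain ⟨F, hF, hFV⟩ := exists_isTIO_of_covariantKraus hU hV
  have hUU (σ : Matrix s s ℂ) : U * (Uᴴ * σ * U) * Uᴴ = σ := by
    simp only [Matrix.mul_assoc, hU, Matrix.mul_one]
    rw [← Matrix.mul_assoc, hU, Matrix.one_mul]
  refine ⟨F, hF, ?_⟩
  have hVA (o : Option _) : V o * (A * Aᴴ) * (V o)ᴴ = (V o * A) * (V o * A)ᴴ := by
    simp only [conjTranspose_mul, Matrix.mul_assoc]
  rw [← hUU ρ, hFV, hA, Fintype.sum_option]
  simp only [hVA, hV_none, hV_some]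
  rw [hBρ', Matrix.zero_mul, zero_add, hUU]
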